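/- For an integer $n\ge 1$, let $B_n$ be the linear polyomino chain with $n$ squares, i.e. the simple graph with $2n+2$ vertices $u_1,\dots,u_{n+1},v_1,\dots,v_{n+1}$ and $3n+1$ edges $u_iu_{i+1}$, $v_iv_{i+1}$ $(1\le i\le n)$ and $u_iv_i$ $(1\le i\le n+1)$. Let $B_n^2$ be the strong prism of $B_n$, i.e. the strong product $B_n\boxtimes K_2$: its vertex set is $V(B_n)\times V(K_2)$, and two distinct vertices $(x,a)$ and $(y,b)$ are adjacent if and only if $x$ and $y$ are equal or adjacent in $B_n$, and $a$ and $b$ are equal or adjacent in $K_2$. For a finite graph $G$, let $\tau(G)$ be the number of spanning trees of $G$. Then for every $n\ge 1$, $$\tau(B_n^2)=\sqrt3\cdot 27\cdot 2^{8n-3}\left[\left(2+\sqrt3\right)^{n+1}-\left(2-\sqrt3\right)^{n+1}\right].$$ -/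

import Mathlib

/-- The strong product `G ⊠ H`: two distinct vertices are adjacent whenever in each of the two
coordinates they are equal or adjacent. -/
def strongProd {V W : Type*} (G : SimpleGraph V) (H : SimpleGraph W) : SimpleGraph (V × W) where
  Adj x y := x ≠ y ∧ (x.1 = y.1 ∨ G.Adj x.1 y.1) ∧ (x.2 = y.2 ∨ H.Adj x.2 y.2)
  symm := ⟨fun _ _ h => ⟨h.1.symm, h.2.1.imp Eq.symm fun e => e.symm,
    h.2.2.imp Eq.symm fun e => e.symm⟩⟩
  loopless := ⟨fun _ h => h.1 rfl⟩

/-- The strong prism of `G`: the strong product of `G` and `K₂`. -/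
def strongPrism {V : Type*} (G : SimpleGraph V) : SimpleGraph (V × Fin 2) :=
  strongProd G (SimpleGraph.completeGraph (Fin 2))

/-- The linear polyomino chain `B_n` with `n` squares. The vertex `(0, i)` is `u_{i+1}` and `(1, i)`
is `v_{i+1}`, for `0 ≤ i ≤ n`; the edges are `u_j u_{j+1}` and `v_j v_{j+1}` for `1 ≤ j ≤ n`, and
the rungs `u_j v_j` for `1 ≤ j ≤ n + 1`. -/
def polyominoChain (n : ℕ) : SimpleGraph (Fin 2 × Fin (n + 1)) where
  Adj x y :=
    (x.1 = y.1 ∧ ((x.2 : ℕ) + 1 = y.2 ∨ (y.2 : ℕ) + 1 = x.2)) ∨ (x.1 ≠ y.1 ∧ x.2 = y.2)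
  symm := ⟨fun _ _ h => h.imp (fun h => ⟨h.1.symm, h.2.symm⟩) fun h => ⟨h.1.symm, h.2.symm⟩⟩
  loopless := ⟨fun x h => by
    rcases h with h | h
    · omega
    · exact h.1 rfl⟩

/-- The number `τ(G)` of spanning trees of a graph `G` on a finite vertex set: a spanning tree is a
tree on the whole vertex set of `G` all of whose edges are edges of `G`. -/
noncomputable def numSpanningTrees {V : Type*} [Finite V] (G : SimpleGraph V) : ℕ :=
  {T : SimpleGraph V | T ≤ G ∧ T.IsTree}.ncard

/-! The count reduces to a product formula for strong prisms and to the ladder's own count. By the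
matrix tree theorem, `det (L + J)` is `N ^ 2` times the number of spanning trees, where `N` is the
number of vertices and `J` the all-ones matrix. Exchanging the two copies of `G` in its prism gives
`L + J` the block form `[X, Y; Y, X]`, so the determinant splits into `X + Y = 2 (L_G + J)` and the
diagonal matrix `X - Y = diag (2 d + 2)`; this is `numSpanningTrees_strongPrism`. Exchanging the two
rails of the ladder splits it in the same way into `L + 2 J` and `L + 2 I` for a path. The first has
a known determinant, as a path has one spanning tree; the second follows the recurrence `u (k + 2) =
4 u (k + 1) - u k`, whose characteristic roots are `2 ± √3`. -/

/-! ### Parent functions and the matrix tree theorem -/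

open Finset in
/-- The row-replaced matrix of a self-map fixing the root `r`: row `v ≠ r` is `e_v - e_{f v}`, row
`r` is `e_r`. Its determinant is `1` if every vertex reaches `r` under `f`. -/
theorem det_parentMatrix_of_reaches {V : Type*} [Fintype V] [DecidableEq V] (r : V) (f : V → V)
    (h : ∀ v, ∃ k, f^[k] v = r) :
    (Matrix.of fun v => if v = r then (Pi.single r 1 : V → ℝ)
      else Pi.single v 1 - Pi.single (f v) 1).det = 1 := by
  classical
  -- Number of steps to the root: `f` strictly lowers it off `r`, so ordering by `d` makes the
  -- matrix triangular with identity diagonal blocks.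
  let d : V → ℕ := fun v => Nat.find (h v)
  have hd : ∀ v, v ≠ r → d (f v) < d v := by
    intro v hv
    have h1 : f^[d v] v = r := Nat.find_spec (h v)
    rcases hk : d v with _ | k
    · rw [hk] at h1
      exact absurd h1 hv
    · rw [hk, Function.iterate_succ_apply] at h1
      exact Nat.lt_succ_of_le (Nat.find_min' (h (f v)) h1)
  have ht : Matrix.BlockTriangular (Matrix.of fun v => if v = r then (Pi.single r 1 : V → ℝ)
      else Pi.single v 1 - Pi.single (f v) 1) (fun v => OrderDual.toDual (d v)) := by
    intro i j hij
    have hij : d i < d j := hij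
    have hne : j ≠ i := by rintro rfl; exact lt_irrefl _ hij
    by_cases hi : i = r
    · subst hi; simp [hne]
    · have : j ≠ f i := by rintro rfl; exact lt_asymm hij (hd i hi)
      simp [hi, hne, this]
  rw [ht.det]
  refine prod_eq_one fun a _ => ?_
  suffices Matrix.toSquareBlock _ _ a = 1 by rw [this, Matrix.det_one]
  ext ⟨i, hi⟩ ⟨j, hj⟩
  have hij : d i = d j := OrderDual.toDual.injective (hi.trans hj.symm)
  simp only [Matrix.toSquareBlock_def, Matrix.of_apply, Matrix.one_apply, Subtype.mk.injEq]
  by_cases hi : i = r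
  · subst hi
    simp [Pi.single_apply, eq_comm]
  · have : j ≠ f i := by rintro rfl; exact absurd hij (hd i hi).ne'
    simp [hi, this, Pi.single_apply, eq_comm]

/-- The indicator of the vertices that never reach `r` is a nonzero kernel vector, being constant
along `f` and zero at `r`. -/
theorem det_parentMatrix_of_not_reaches {V : Type*} [Fintype V] [DecidableEq V] (r : V) (f : V → V)
    (h : ¬ ∀ v, ∃ k, f^[k] v = r) :
    (Matrix.of fun v => if v = r then (Pi.single r 1 : V → ℝ)
      else Pi.single v 1 - Pi.single (f v) 1).det = 0 := by
  classical
  push Not at h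
  obtain ⟨v₀, hv₀⟩ := h
  rw [← Matrix.exists_mulVec_eq_zero_iff]
  refine ⟨fun v => if ∃ k, f^[k] v = r then 0 else 1, ?_, ?_⟩
  · intro h0
    have := congrFun h0 v₀
    simp [hv₀] at this
  · ext v
    by_cases hv : v = r
    · subst hv
      have : ∃ k, f^[k] v = v := ⟨0, rfl⟩
      simp [Matrix.mulVec, this]
    · have : (∃ k, f^[k] v = r) ↔ ∃ k, f^[k] (f v) = r := by
        constructor
        · rintro ⟨_ | k, hk⟩
          · exact absurd hk hv
          · exact ⟨k, hk⟩
        · rintro ⟨k, hk⟩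
          exact ⟨k + 1, hk⟩
      simp only [Matrix.mulVec, Matrix.of_apply, if_neg hv, Pi.zero_apply]
      rw [sub_dotProduct]
      simp [this]

/-- The graph with an edge from each vertex to its image under `f`. -/
def parentGraph {V : Type*} (f : V → V) : SimpleGraph V :=
  SimpleGraph.fromRel fun v w => f v = w

theorem parentGraph_adj {V : Type*} (f : V → V) (v w : V) :
    (parentGraph f).Adj v w ↔ v ≠ w ∧ (f v = w ∨ f w = v) :=
  SimpleGraph.fromRel_adj _ _ _

theorem parentGraph_connected {V : Type*} (r : V) (f : V → V) (h : ∀ v, ∃ k, f^[k] v = r) :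
    (parentGraph f).Connected := by
  have hr : ∀ k v, f^[k] v = r → (parentGraph f).Reachable v r := by
    intro k
    induction k with
    | zero => rintro v rfl; exact SimpleGraph.Reachable.refl _
    | succ k ih =>
      intro v hv
      refine SimpleGraph.Reachable.trans ?_ (ih (f v) hv)
      by_cases hvf : v = f v
      · rw [← hvf]
      · exact SimpleGraph.Adj.reachable ((parentGraph_adj f _ _).2 ⟨hvf, Or.inl rfl⟩)
  have hr' : ∀ v, (parentGraph f).Reachable v r := fun v => (h v).elim fun k => hr k v
  exact (SimpleGraph.connected_iff _).2 ⟨fun v w => (hr' v).trans (hr' w).symm, ⟨r⟩⟩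

/-- Each edge is `s(v, f v)` for some `v ≠ r`, so a connected graph with at most `|V| - 1` edges
results. -/
theorem parentGraph_isTree {V : Type*} [Finite V] (r : V) (f : V → V) (hfr : f r = r)
    (h : ∀ v, ∃ k, f^[k] v = r) : (parentGraph f).IsTree := by
  have hc := parentGraph_connected r f h
  refine SimpleGraph.isTree_iff_connected_and_card.2 ⟨hc, le_antisymm ?_
    hc.card_vert_le_card_edgeSet_add_one⟩
  have hsub : (parentGraph f).edgeSet ⊆ (fun v => s(v, f v)) '' {r}ᶜ := by
    intro e
    induction e with | _ a b
    rw [SimpleGraph.mem_edgeSet, parentGraph_adj]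
    rintro ⟨hab, rfl | rfl⟩
    · refine ⟨a, ?_, rfl⟩
      rintro rfl
      exact hab hfr.symm
    · refine ⟨b, ?_, Sym2.eq_swap⟩
      rintro rfl
      exact hab hfr
  have h1 := (Set.ncard_le_ncard hsub (Set.toFinite _)).trans (Set.ncard_image_le (Set.toFinite _))
  have h2 := Set.ncard_add_ncard_compl ({r} : Set V)
  rw [Set.ncard_singleton] at h2
  rw [Nat.card_coe_set_eq]
  omega

theorem iterate_ne_of_reaches {V : Type*} (r : V) (f : V → V) (hfr : f r = r) {v w : V}
    (hvr : v ≠ r) (hv : f v = w) (hw : f w = v) (k : ℕ) : f^[k] v ≠ r := by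
  have hwr : w ≠ r := by
    rintro rfl
    exact hvr (hw.symm.trans hfr)
  suffices f^[k] v = v ∨ f^[k] v = w by
    rcases this with h | h <;> rw [h] <;> assumption
  induction k with
  | zero => exact Or.inl rfl
  | succ k ih =>
    rw [Function.iterate_succ_apply']
    rcases ih with h | h
    · right; rw [h, hv]
    · left; rw [h, hw]

/-- Induction on the number of `g`-steps to `r`. The edge from `v` to `g v` also comes from `f`; if
it is not `f v = g v`, then `f (g v) = v`, and by induction `g (g v) = v`, a 2-cycle that never
reaches `r`. -/
theorem parentGraph_injOn {V : Type*} (r : V) {f g : V → V} (hfr : f r = r) (hgr : g r = r)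
    (hf0 : ∀ v ≠ r, f v ≠ v) (hg0 : ∀ v ≠ r, g v ≠ v)
    (hg : ∀ v, ∃ k, g^[k] v = r) (h : parentGraph f = parentGraph g) : f = g := by
  have key : ∀ k v, g^[k] v = r → f v = g v := by
    intro k
    induction k with
    | zero => rintro v rfl; exact hfr.trans hgr.symm
    | succ k ih =>
      intro v hv
      by_cases hvr : v = r
      · rw [hvr, hfr, hgr]
      have ihw := ih (g v) hv
      have hadj : (parentGraph f).Adj v (g v) := by
        rw [h, parentGraph_adj]
        exact ⟨(hg0 v hvr).symm, Or.inl rfl⟩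
      rcases ((parentGraph_adj f _ _).1 hadj).2 with h1 | h1
      · exact h1
      · obtain ⟨k', hk'⟩ := hg v
        exact absurd hk' (iterate_ne_of_reaches r g hgr hvr rfl (ihw.symm.trans h1) k')
  funext v
  exact (hg v).elim fun k => key k v

/-- The parent of `v` is the next vertex on a shortest walk to `r`. The resulting connected subgraph
is all of `T`, since trees are minimal connected graphs. -/
theorem exists_parent_of_isTree {V : Type*} (r : V) {T : SimpleGraph V}
    (hT : T.IsTree) : ∃ f : V → V, f r = r ∧ (∀ v ≠ r, T.Adj v (f v)) ∧
      (∀ v, ∃ k, f^[k] v = r) ∧ parentGraph f = T := by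
  classical
  have hc := hT.1
  have hstep : ∀ v, v ≠ r → ∃ w, T.Adj v w ∧ T.dist w r < T.dist v r := by
    intro v hv
    obtain ⟨p, hp⟩ := hc.exists_walk_length_eq_dist v r
    cases p with
    | nil => exact absurd rfl hv
    | cons hadj q =>
      refine ⟨_, hadj, ?_⟩
      rw [SimpleGraph.Walk.length_cons] at hp
      have := SimpleGraph.dist_le q
      omega
  choose! g hg using hstep
  let f : V → V := fun v => if v = r then r else g v
  have hf : ∀ v, v ≠ r → f v = g v := fun v hv => if_neg hv
  have hreach : ∀ v, ∃ k, f^[k] v = r := by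
    intro v
    induction hn : T.dist v r using Nat.strong_induction_on generalizing v with
    | _ n ih =>
      by_cases hv : v = r
      · exact ⟨0, hv⟩
      · obtain ⟨k, hk⟩ := ih _ (hn ▸ (hg v hv).2) (g v) rfl
        exact ⟨k + 1, by rw [Function.iterate_succ_apply, hf v hv, hk]⟩
  have hadj : ∀ v ≠ r, T.Adj v (f v) := fun v hv => by rw [hf v hv]; exact (hg v hv).1
  have hfr : f r = r := if_pos rfl
  refine ⟨f, hfr, hadj, hreach, ?_⟩
  have hle : parentGraph f ≤ T := by
    intro a b hab
    obtain ⟨hne, rfl | rfl⟩ := (parentGraph_adj f _ _).1 hab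
    · refine hadj a ?_
      rintro rfl
      exact hne hfr.symm
    · refine (hadj b ?_).symm
      rintro rfl
      exact hne hfr
  exact le_antisymm hle
    ((SimpleGraph.isTree_iff_minimal_connected.1 hT).2 (parentGraph_connected r f hreach) hle)

open Finset in
theorem numSpanningTrees_eq_card_parent {V : Type*} [Fintype V] [DecidableEq V]
    (G : SimpleGraph V) [DecidableRel G.Adj] (r : V)
    [DecidablePred fun f : V → V => ∀ v, ∃ k, f^[k] v = r] :
    numSpanningTrees G = #{f ∈ Fintype.piFinset fun v => if v = r then {r} else G.neighborFinset v |
      ∀ v, ∃ k, f^[k] v = r} := by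
  have hmem : ∀ f : V → V, (f ∈ Fintype.piFinset fun v => if v = r then {r}
      else G.neighborFinset v) ↔ f r = r ∧ ∀ v ≠ r, G.Adj v (f v) := by
    intro f
    rw [Fintype.mem_piFinset]
    constructor
    · intro h
      refine ⟨by simpa using h r, fun v hv => by simpa [hv] using h v⟩
    · rintro ⟨h1, h2⟩ v
      by_cases hv : v = r
      · subst hv; simp [h1]
      · simpa [hv] using h2 v hv
  rw [numSpanningTrees, ← Set.ncard_coe_finset]
  symm
  refine Set.ncard_congr (fun f _ => parentGraph f) ?_ ?_ ?_
  · intro f hf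
    simp only [coe_filter, Set.mem_ofPred_eq, hmem] at hf
    obtain ⟨⟨hfr, hadj⟩, hr⟩ := hf
    refine ⟨?_, parentGraph_isTree r f hfr hr⟩
    intro a b hab
    obtain ⟨hne, rfl | rfl⟩ := (parentGraph_adj f _ _).1 hab
    · refine hadj a ?_
      rintro rfl
      exact hne hfr.symm
    · refine (hadj b ?_).symm
      rintro rfl
      exact hne hfr
  · intro f g hf hg h
    simp only [coe_filter, Set.mem_ofPred_eq, hmem] at hf hg
    exact parentGraph_injOn r hf.1.1 hg.1.1 (fun v hv => (hf.1.2 v hv).ne')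
      (fun v hv => (hg.1.2 v hv).ne') hg.2 h
  · rintro T ⟨hle, hT⟩
    obtain ⟨f, hfr, hadj, hr, rfl⟩ := exists_parent_of_isTree r hT
    refine ⟨f, ?_, rfl⟩
    simp only [coe_filter, Set.mem_ofPred_eq, hmem]
    exact ⟨⟨hfr, fun v hv => hle (hadj v hv)⟩, hr⟩

theorem lapMatrix_row_eq_sum {V : Type*} [Fintype V] [DecidableEq V]
    (G : SimpleGraph V) [DecidableRel G.Adj] (v : V) :
    G.lapMatrix ℝ v = ∑ w ∈ G.neighborFinset v, (Pi.single v 1 - Pi.single w 1 : V → ℝ) := by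
  ext w
  simp [SimpleGraph.lapMatrix, SimpleGraph.degMatrix, Matrix.diagonal_apply, Pi.single_apply,
    SimpleGraph.adjMatrix_apply, Finset.sum_sub_distrib, eq_comm]

/-- **Matrix tree theorem**, with the row of a vertex `r` replaced by the unit row vector `e_r`. -/
theorem numSpanningTrees_eq_det {V : Type*} [Fintype V] [DecidableEq V]
    (G : SimpleGraph V) [DecidableRel G.Adj] (r : V) :
    (numSpanningTrees G : ℝ) = ((G.lapMatrix ℝ).updateRow r (Pi.single r 1)).det := by
  classical
  let g : V → V → V → ℝ := fun v w =>
    if v = r then Pi.single r 1 else Pi.single v 1 - Pi.single w 1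
  have hrows : (G.lapMatrix ℝ).updateRow r (Pi.single r 1) =
      fun v => ∑ w ∈ (if v = r then {r} else G.neighborFinset v), g v w := by
    funext v
    by_cases hv : v = r
    · subst hv; simp [g]
    · simp only [Matrix.updateRow_ne hv, g, if_neg hv]
      exact lapMatrix_row_eq_sum G v
  rw [hrows]
  change _ = (Matrix.detRowAlternating (n := V) (R := ℝ)).toMultilinearMap _
  -- Expanding every row by multilinearity yields one determinant per choice of a neighbour for each
  -- `v ≠ r`.
  rw [MultilinearMap.map_sum_finset, numSpanningTrees_eq_card_parent G r, Finset.card_filter,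
    Nat.cast_sum]
  refine Finset.sum_congr rfl fun f _ => ?_
  split_ifs with h
  · rw [Nat.cast_one]; exact (det_parentMatrix_of_reaches r f h).symm
  · rw [Nat.cast_zero]; exact (det_parentMatrix_of_not_reaches r f h).symm

/-! ### Determinants: rank-one shifts, two-by-two blocks, Hessenberg matrices -/

theorem det_updateRow_const_of_rowSum_zero {V : Type*} [Fintype V] [DecidableEq V]
    (M : Matrix V V ℝ) (hrow : ∀ i, ∑ j, M i j = 0) (r : V) (c : ℝ) :
    (M.updateRow r fun _ => c).det =
      c * Fintype.card V * (M.updateRow r (Pi.single r 1)).det := by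
  -- The difference of the two candidate rows sums to zero, so the all-ones vector lies in the
  -- kernel.
  have h0 : (M.updateRow r ((fun _ => c) - (c * Fintype.card V) • Pi.single r 1)).det = 0 := by
    rw [← Matrix.exists_mulVec_eq_zero_iff]
    refine ⟨fun _ => 1, fun h => one_ne_zero (congrFun h r), ?_⟩
    ext i
    by_cases hi : i = r
    · subst hi
      simp [Matrix.mulVec, dotProduct, Pi.single_apply, mul_comm]
    · simp [Matrix.mulVec, dotProduct, hi, hrow]
  have h1 := Matrix.det_updateRow_add M r ((fun _ => c) - (c * Fintype.card V) • Pi.single r 1)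
    ((c * Fintype.card V) • Pi.single r 1)
  rw [sub_add_cancel, h0, zero_add, Matrix.det_updateRow_smul] at h1
  exact h1

/-- For a matrix with vanishing row and column sums, adding the constant `c` to all entries gives
a multiple of the principal minors. -/
theorem det_add_const_of_sum_zero {V : Type*} [Fintype V] [DecidableEq V]
    (M : Matrix V V ℝ) (hrow : ∀ i, ∑ j, M i j = 0) (hcol : ∀ j, ∑ i, M i j = 0) (r : V) (c : ℝ) :
    (M + Matrix.of fun _ _ => c).det =
      c * (Fintype.card V) ^ 2 * (M.updateRow r (Pi.single r 1)).det := by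
  have hN : (Fintype.card V : ℝ) ≠ 0 := by
    have : Nonempty V := ⟨r⟩
    exact_mod_cast Fintype.card_ne_zero
  -- Adding all rows to row `r` makes it constant; multiples of it then remove `c` from the other
  -- rows.
  have h1 := Matrix.det_updateRow_sum (M + Matrix.of fun _ _ => c) r (fun _ => 1)
  have h2 : (∑ k, (1 : ℝ) • (M + Matrix.of fun _ _ => c : Matrix V V ℝ) k) = fun _ => c * Fintype.card V := by
    ext j
    simp only [one_smul]
    refine (Finset.sum_apply j _ _).trans ?_
    simp [Finset.sum_add_distrib, hcol, mul_comm]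
  rw [one_smul] at h1
  rw [← h1, h2]
  have h3 : ((M + Matrix.of fun _ _ => c).updateRow r fun _ => c * Fintype.card V).det =
      (M.updateRow r fun _ => c * Fintype.card V).det := by
    refine Matrix.det_eq_of_forall_row_eq_smul_add_const
      (fun i => if i = r then 0 else (Fintype.card V : ℝ)⁻¹) r (if_pos rfl) ?_
    intro i j
    by_cases hi : i = r
    · subst hi; simp
    · simp [hi]
      field_simp
  rw [h3, det_updateRow_const_of_rowSum_zero M hrow]
  ring

/-- The determinant of a two-by-two block matrix `[X, Y; Y, X]`. -/
theorem det_of_twoBlock {V : Type*} [Fintype V] [DecidableEq V] (X Y : Matrix V V ℝ) :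
    (Matrix.of fun p q : V × Fin 2 => if p.2 = q.2 then X p.1 q.1 else Y p.1 q.1).det =
      (X + Y).det * (X - Y).det := by
  let e : V × Fin 2 ≃ V ⊕ V :=
    { toFun := fun p => if p.2 = 0 then Sum.inl p.1 else Sum.inr p.1
      invFun := Sum.elim (fun v => (v, 0)) fun v => (v, 1)
      left_inv := by rintro ⟨v, i⟩; fin_cases i <;> rfl
      right_inv := by rintro (v | v) <;> rfl }
  have h1 : (Matrix.of fun p q : V × Fin 2 => if p.2 = q.2 then X p.1 q.1 else Y p.1 q.1) =
      (Matrix.fromBlocks X Y Y X).submatrix e e := by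
    ext ⟨v, i⟩ ⟨w, j⟩
    fin_cases i <;> fin_cases j <;> simp [e]
  rw [h1, Matrix.det_submatrix_equiv_self]
  have h2 : Matrix.fromBlocks 1 0 1 1 * Matrix.fromBlocks X Y Y X * Matrix.fromBlocks 1 0 (-1) 1 =
      Matrix.fromBlocks (X - Y) Y 0 (X + Y) := by
    simp [Matrix.fromBlocks_multiply]
    refine ⟨by abel, by abel, by abel⟩
  have h3 := congrArg Matrix.det h2
  rw [Matrix.det_mul, Matrix.det_mul, Matrix.det_fromBlocks_zero₁₂, Matrix.det_fromBlocks_zero₁₂,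
    Matrix.det_fromBlocks_zero₂₁] at h3
  simpa [mul_comm] using h3

/-- The determinant of a lower Hessenberg matrix with superdiagonal entries `-1`, from a vector
starting with `1` which all rows but the last annihilate. -/
theorem det_of_hessenberg {n : ℕ} (M : Matrix (Fin (n + 1)) (Fin (n + 1)) ℝ)
    (h0 : ∀ i j : Fin (n + 1), (i : ℕ) + 1 < j → M i j = 0)
    (h1 : ∀ i j : Fin (n + 1), (i : ℕ) + 1 = j → M i j = -1)
    (x : Fin (n + 1) → ℝ) (hx : x 0 = 1) (c : ℝ)
    (h : M.mulVec x = Pi.single (Fin.last n) c) : M.det = c := by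
  -- As `x 0 = 1`, column `0` may be replaced by `M x`, whose only possibly nonzero entry is the
  -- last. Its minor is triangular with diagonal `-1`, and the two signs `(-1) ^ n` cancel.
  have h2 := Matrix.det_updateCol_sum M 0 x
  have h3 : (fun k => ∑ i, x i • M k i) = Pi.single (Fin.last n) c := by
    rw [← h]; ext k; simp [Matrix.mulVec, dotProduct, mul_comm]
  rw [h3, hx, one_smul] at h2
  rw [← h2, Matrix.det_succ_column_zero, Finset.sum_eq_single (Fin.last n)]
  · have h4 : (((M.updateCol 0 (Pi.single (Fin.last n) c)).submatrix
        (Fin.last n).succAbove Fin.succ).det) = (-1) ^ n := by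
      rw [Matrix.det_of_isLowerTriangular]
      · simp [h1]
      · intro i j hij
        have hij : i < j := hij
        simp only [Matrix.submatrix_apply, Fin.succAbove_last]
        rw [Matrix.updateCol_ne (Fin.succ_ne_zero _)]
        exact h0 _ _ (by simpa using hij)
    rw [h4]
    simp only [Fin.val_last, Matrix.updateCol_self, Pi.single_eq_same]
    rw [mul_right_comm, ← mul_pow]
    simp
  · intro i _ hi
    simp [hi]
  · simp

/-! ### Spanning trees of a strong prism -/

open SimpleGraph

theorem det_lapMatrix_add_const {V : Type*} [Fintype V] [DecidableEq V] (G : SimpleGraph V)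
    [DecidableRel G.Adj] (r : V) (c : ℝ) :
    (G.lapMatrix ℝ + Matrix.of fun _ _ => c).det =
      c * (Fintype.card V) ^ 2 * ((G.lapMatrix ℝ).updateRow r (Pi.single r 1)).det := by
  have hrow : ∀ i, ∑ j, G.lapMatrix ℝ i j = 0 := fun i => by
    simpa [Matrix.mulVec, dotProduct] using congrFun (G.lapMatrix_mulVec_const_eq_zero (R := ℝ)) i
  refine det_add_const_of_sum_zero _ hrow (fun j => ?_) r c
  rw [← hrow j]
  exact Finset.sum_congr rfl fun i _ => (G.isSymm_lapMatrix (R := ℝ)).apply j i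

theorem lapMatrix_apply {V : Type*} [Fintype V] [DecidableEq V] (G : SimpleGraph V)
    [DecidableRel G.Adj] (v w : V) :
    G.lapMatrix ℝ v w = (if v = w then (G.degree v : ℝ) else 0) - if G.Adj v w then 1 else 0 := by
  simp [lapMatrix, degMatrix, Matrix.diagonal_apply, adjMatrix_apply]

theorem strongPrism_adj {V : Type*} (G : SimpleGraph V) (x y : V) (a b : Fin 2) :
    (strongPrism G).Adj (x, a) (y, b) ↔ G.Adj x y ∨ (x = y ∧ a ≠ b) := by
  have hG : G.Adj x y → x ≠ y := Adj.ne
  simp only [strongPrism, strongProd, completeGraph, top_adj, ne_eq, Prod.mk.injEq]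
  tauto

theorem strongPrism_degree {V : Type*} [Fintype V] [DecidableEq V] (G : SimpleGraph V)
    [DecidableRel G.Adj] [DecidableRel (strongPrism G).Adj] (x : V) (a : Fin 2) :
    ((strongPrism G).degree (x, a) : ℝ) = 2 * G.degree x + 1 := by
  rw [degree_eq_sum_if_adj, degree_eq_sum_if_adj, Fintype.sum_prod_type]
  have h : ∀ y, ∑ b : Fin 2, (if (strongPrism G).Adj (x, a) (y, b) then (1 : ℝ) else 0) =
      2 * (if G.Adj x y then 1 else 0) + if x = y then 1 else 0 := by
    intro y
    have hG : G.Adj x y → x ≠ y := Adj.ne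
    simp only [strongPrism_adj]
    by_cases h1 : G.Adj x y
    · simp [h1, hG h1]
    · by_cases h2 : x = y <;> fin_cases a <;> simp [h1, h2]
  simp only [h, Finset.sum_add_distrib, ← Finset.mul_sum]
  simp

/-- The number of spanning trees of a strong prism. -/
theorem numSpanningTrees_strongPrism {V : Type*} [Fintype V] [DecidableEq V] [Nonempty V]
    (G : SimpleGraph V) [DecidableRel G.Adj] :
    4 * (numSpanningTrees (strongPrism G) : ℝ) =
      2 ^ Fintype.card V * numSpanningTrees G * ∏ v, (2 * (G.degree v : ℝ) + 2) := by
  classical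
  obtain ⟨r⟩ := ‹Nonempty V›
  have hN : (Fintype.card V : ℝ) ≠ 0 := by
    have : Nonempty V := ⟨r⟩
    exact_mod_cast Fintype.card_ne_zero
  have h1 := det_lapMatrix_add_const (strongPrism G) (r, 0) 1
  rw [← numSpanningTrees_eq_det] at h1
  have h2 := det_lapMatrix_add_const G r 1
  rw [← numSpanningTrees_eq_det] at h2
  let J : Matrix V V ℝ := Matrix.of fun _ _ => 1
  let X : Matrix V V ℝ :=
    Matrix.diagonal (fun v => 2 * (G.degree v : ℝ) + 1) - G.adjMatrix ℝ + J
  let Y : Matrix V V ℝ := J - G.adjMatrix ℝ - 1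
  have h3 : (strongPrism G).lapMatrix ℝ + Matrix.of (fun _ _ => 1) =
      Matrix.of fun p q : V × Fin 2 => if p.2 = q.2 then X p.1 q.1 else Y p.1 q.1 := by
    ext ⟨x, a⟩ ⟨y, b⟩
    have hG : G.Adj x y → x ≠ y := Adj.ne
    simp only [Matrix.add_apply, lapMatrix_apply, strongPrism_adj, strongPrism_degree, X, Y, J,
      Matrix.of_apply, Matrix.sub_apply, Matrix.diagonal_apply, adjMatrix_apply, Matrix.one_apply,
      Prod.mk.injEq]
    by_cases hxy : x = y
    · subst hxy
      by_cases hab : a = b <;> simp [hab]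
    · by_cases hab : a = b <;> simp [hab, hxy]
      ring
  have h4 : X + Y = (2 : ℝ) • (G.lapMatrix ℝ + Matrix.of fun _ _ => 1) := by
    ext x y
    simp only [X, Y, J, lapMatrix_apply, Matrix.add_apply, Matrix.sub_apply, Matrix.smul_apply,
      Matrix.of_apply, Matrix.diagonal_apply, adjMatrix_apply, Matrix.one_apply, smul_eq_mul]
    split_ifs <;> ring
  have h5 : X - Y = Matrix.diagonal fun v => 2 * (G.degree v : ℝ) + 2 := by
    ext x y
    simp only [X, Y, J, Matrix.add_apply, Matrix.sub_apply, Matrix.of_apply,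
      Matrix.diagonal_apply, adjMatrix_apply, Matrix.one_apply]
    split_ifs <;> ring
  rw [h3, det_of_twoBlock, h4, h5, Matrix.det_smul, h2, Matrix.det_diagonal] at h1
  simp only [Fintype.card_prod, Fintype.card_fin, Nat.cast_mul, Nat.cast_ofNat] at h1
  refine mul_left_cancel₀ (pow_ne_zero 2 hN) ?_
  linear_combination -h1

/-! ### Path Laplacians -/

theorem sum_pathGraph_neighborFinset (n : ℕ) (i : Fin (n + 1))
    [Fintype ((pathGraph (n + 1)).neighborSet i)] (y : ℕ → ℝ) :
    ∑ j ∈ (pathGraph (n + 1)).neighborFinset i, y j =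
      (if (i : ℕ) = 0 then 0 else y (i - 1)) + if (i : ℕ) = n then 0 else y (i + 1) := by
  classical
  have h1 : (pathGraph (n + 1)).neighborFinset i =
      Finset.univ.filter (fun j : Fin (n + 1) => (j : ℕ) + 1 = i) ∪
        Finset.univ.filter (fun j : Fin (n + 1) => (i : ℕ) + 1 = j) := by
    ext j
    simp [pathGraph_adj, or_comm]
  rw [h1, Finset.sum_union]
  · congr 1
    · split_ifs with h
      · refine Finset.sum_eq_zero fun j hj => ?_
        have := (Finset.mem_filter.1 hj).2
        omega
      · rw [Finset.sum_eq_single (⟨i - 1, by omega⟩ : Fin (n + 1))]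
        · intro j hj hne
          have := (Finset.mem_filter.1 hj).2
          exact absurd (Fin.ext (by simp; omega)) hne
        · intro hn
          exact absurd (Finset.mem_filter.2 ⟨Finset.mem_univ _, by simp; omega⟩) hn
    · split_ifs with h
      · refine Finset.sum_eq_zero fun j hj => ?_
        have := (Finset.mem_filter.1 hj).2
        omega
      · rw [Finset.sum_eq_single (⟨i + 1, by omega⟩ : Fin (n + 1))]
        · intro j hj hne
          have := (Finset.mem_filter.1 hj).2
          exact absurd (Fin.ext (by simp; omega)) hne
        · intro hn
          exact absurd (Finset.mem_filter.2 ⟨Finset.mem_univ _, by simp⟩) hn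
  · rw [Finset.disjoint_left]
    intro j hj hj'
    have := (Finset.mem_filter.1 hj).2
    have := (Finset.mem_filter.1 hj').2
    omega

theorem pathGraph_degree (n : ℕ) (i : Fin (n + 1))
    [Fintype ((pathGraph (n + 1)).neighborSet i)] :
    ((pathGraph (n + 1)).degree i : ℝ) =
      (if (i : ℕ) = 0 then 0 else 1) + if (i : ℕ) = n then 0 else 1 := by
  have := sum_pathGraph_neighborFinset n i fun _ => 1
  simpa using this

theorem pathGraph_lapMatrix_mulVec (n : ℕ) [DecidableRel (pathGraph (n + 1)).Adj]
    (y : ℕ → ℝ) (i : Fin (n + 1)) :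
    ((pathGraph (n + 1)).lapMatrix ℝ).mulVec (fun j => y j) i =
      (if (i : ℕ) = 0 then 0 else y i - y (i - 1)) +
        if (i : ℕ) = n then 0 else y i - y (i + 1) := by
  rw [lapMatrix_mulVec_apply, sum_pathGraph_neighborFinset, pathGraph_degree]
  split_ifs <;> ring

theorem det_pathGraph_lapMatrix_updateRow (n : ℕ) [DecidableRel (pathGraph (n + 1)).Adj] :
    (((pathGraph (n + 1)).lapMatrix ℝ).updateRow (Fin.last n) (Pi.single (Fin.last n) 1)).det
      = 1 := by
  refine det_of_hessenberg _ ?_ ?_ (fun _ => 1) rfl 1 ?_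
  · intro i j hij
    have hi : i ≠ Fin.last n := by rintro rfl; simp at hij; omega
    have hij' : i ≠ j := by rintro rfl; omega
    rw [Matrix.updateRow_ne hi, lapMatrix_apply, if_neg hij', if_neg, sub_zero]
    rw [pathGraph_adj]
    omega
  · intro i j hij
    have hi : i ≠ Fin.last n := by rintro rfl; simp at hij; omega
    have hij' : i ≠ j := by rintro rfl; omega
    rw [Matrix.updateRow_ne hi, lapMatrix_apply, if_neg hij', if_pos, zero_sub]
    rw [pathGraph_adj]
    exact Or.inl hij
  · ext i
    by_cases hi : i = Fin.last n
    · subst hi; simp [Matrix.mulVec]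
    · have := pathGraph_lapMatrix_mulVec n (fun _ => 1) i
      simp only [sub_self, ite_self, add_zero] at this
      rw [Pi.single_eq_of_ne hi, ← this]
      simp only [Matrix.mulVec, Matrix.updateRow_ne hi]

/-- The vector `x k = u (k + 1) - u k` satisfies the first row `3 x 0 = x 1` and the inner rows of
the kernel equation; the last row evaluates to `3 u (n + 2) - 4 u (n + 1) + u n = 2 u (n + 2)`. -/
theorem det_pathGraph_lapMatrix_add_two (n : ℕ) [DecidableRel (pathGraph (n + 2)).Adj]
    (u : ℕ → ℝ) (h0 : u 0 = 0) (h1 : u 1 = 1) (hu : ∀ k, u (k + 2) = 4 * u (k + 1) - u k) :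
    ((pathGraph (n + 2)).lapMatrix ℝ + (2 : ℝ) • 1).det = 2 * u (n + 2) := by
  refine det_of_hessenberg _ ?_ ?_ (fun k => u (k + 1) - u k) (by simp [h0, h1]) _ ?_
  · intro i j hij
    have hij' : i ≠ j := by rintro rfl; omega
    rw [Matrix.add_apply, lapMatrix_apply, if_neg hij', if_neg, Matrix.smul_apply,
      Matrix.one_apply_ne hij']
    · simp
    rw [pathGraph_adj]
    omega
  · intro i j hij
    have hij' : i ≠ j := by rintro rfl; omega
    rw [Matrix.add_apply, lapMatrix_apply, if_neg hij', if_pos, Matrix.smul_apply,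
      Matrix.one_apply_ne hij']
    · simp
    rw [pathGraph_adj]
    exact Or.inl hij
  · ext i
    rw [Matrix.add_mulVec, Pi.add_apply,
      pathGraph_lapMatrix_mulVec (n + 1) (fun k => u (k + 1) - u k) i, Matrix.smul_mulVec,
      Matrix.one_mulVec]
    obtain ⟨i, hi⟩ := i
    simp only [Pi.smul_apply, smul_eq_mul, Pi.single_apply, Fin.ext_iff, Fin.val_last]
    rcases i with _ | i
    · have := hu 0
      simp only [zero_add, h0, h1] at this
      simp [this, h0, h1]
      norm_num
    · have e1 := hu i
      have e2 := hu (i + 1)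
      by_cases hin : i = n
      · subst hin
        simp
        linear_combination e1
      · simp [hin]
        simp only [add_assoc, Nat.reduceAdd] at e1 e2 ⊢
        linear_combination e1 - e2

/-! ### The ladder and the final formula -/

theorem polyominoChain_adj_iff (n : ℕ) (a b : Fin 2) (k l : Fin (n + 1)) :
    (polyominoChain n).Adj (a, k) (b, l) ↔
      (a = b ∧ (pathGraph (n + 1)).Adj k l) ∨ (a ≠ b ∧ k = l) := by
  rw [pathGraph_adj]
  rfl

theorem polyominoChain_degree (n : ℕ) [DecidableRel (polyominoChain n).Adj]
    [DecidableRel (pathGraph (n + 1)).Adj] (a : Fin 2) (k : Fin (n + 1)) :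
    ((polyominoChain n).degree (a, k) : ℝ) = (pathGraph (n + 1)).degree k + 1 := by
  rw [degree_eq_sum_if_adj, degree_eq_sum_if_adj, Fintype.sum_prod_type]
  simp only [polyominoChain_adj_iff]
  fin_cases a <;> simp [Fin.sum_univ_two, Finset.filter_eq, add_comm]

/-- The number of spanning trees of the ladder with `n + 2` rungs. -/
theorem numSpanningTrees_polyominoChain (n : ℕ) (u : ℕ → ℝ) (h0 : u 0 = 0) (h1 : u 1 = 1)
    (hu : ∀ k, u (k + 2) = 4 * u (k + 1) - u k) :
    (numSpanningTrees (polyominoChain (n + 1)) : ℝ) = u (n + 2) := by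
  classical
  have hdet := det_lapMatrix_add_const (polyominoChain (n + 1)) (0, 0) 1
  rw [← numSpanningTrees_eq_det] at hdet
  let L := (pathGraph (n + 2)).lapMatrix ℝ
  let J : Matrix (Fin (n + 2)) (Fin (n + 2)) ℝ := Matrix.of fun _ _ => 1
  -- Each rung raises the degrees on both rails by one, hence `L + 1`, and contributes `-1` between
  -- the rails.
  have h3 : (polyominoChain (n + 1)).lapMatrix ℝ + Matrix.of (fun _ _ => 1) =
      (Matrix.of fun p q : Fin (n + 2) × Fin 2 =>
        if p.2 = q.2 then (L + 1 + J) p.1 q.1 else (J - 1) p.1 q.1).submatrix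
          (Equiv.prodComm _ _) (Equiv.prodComm _ _) := by
    ext ⟨a, k⟩ ⟨b, l⟩
    simp only [Matrix.add_apply, lapMatrix_apply, polyominoChain_adj_iff, polyominoChain_degree,
      L, J, Matrix.of_apply, Matrix.sub_apply, Matrix.one_apply, Prod.mk.injEq,
      Matrix.submatrix_apply, Equiv.prodComm_apply, Prod.swap_prod_mk]
    by_cases hkl : k = l
    · subst hkl
      by_cases hab : a = b <;> simp [hab]
    · by_cases hab : a = b <;> simp [hab, hkl]
  have h4 : L + 1 + J + (J - 1) = L + Matrix.of fun _ _ => 2 := by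
    ext k l
    simp [J]
    ring
  have h5 : L + 1 + J - (J - 1) = L + (2 : ℝ) • 1 := by
    rw [two_smul]; abel
  rw [h3, Matrix.det_submatrix_equiv_self, det_of_twoBlock, h4, h5,
    det_lapMatrix_add_const _ (Fin.last (n + 1)), det_pathGraph_lapMatrix_updateRow,
    det_pathGraph_lapMatrix_add_two n u h0 h1 hu] at hdet
  simp only [Fintype.card_prod, Fintype.card_fin] at hdet
  push_cast at hdet
  have hN : ((n : ℝ) + 2) ≠ 0 := by positivity
  refine mul_left_cancel₀ (pow_ne_zero 2 hN) ?_
  linear_combination -hdet / 4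

theorem prod_polyominoChain_degree (n : ℕ) [DecidableRel (polyominoChain (n + 1)).Adj] :
    ∏ v, (2 * ((polyominoChain (n + 1)).degree v : ℝ) + 2) = (36 * 8 ^ n) ^ 2 := by
  classical
  rw [Fintype.prod_prod_type]
  simp only [polyominoChain_degree, pathGraph_degree, Fin.prod_univ_two]
  have h : ∏ k : Fin (n + 2), (2 * ((if (k : ℕ) = 0 then (0 : ℝ) else 1) +
      (if (k : ℕ) = n + 1 then 0 else 1) + 1) + 2) = 36 * 8 ^ n := by
    -- On one rail the two corners have degree 2 and give a factor 6 each; the `n` inner vertices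
    -- have degree 3 and give 8.
    rw [Fin.prod_univ_succ, Fin.prod_univ_castSucc]
    have : ∀ i : Fin n, (i : ℕ) ≠ n := fun i => i.2.ne
    simp [this]
    norm_num
    ring
  rw [h, sq]

theorem theorem3p5 (n : ℕ) (hn : 1 ≤ n) :
    (numSpanningTrees (strongPrism (polyominoChain n)) : ℝ) =
      √3 * 27 * (2 : ℝ) ^ (8 * (n : ℤ) - 3) *
        ((2 + √3) ^ (n + 1) - (2 - √3) ^ (n + 1)) := by
  classical
  obtain ⟨m, rfl⟩ : ∃ m, n = m + 1 := ⟨n - 1, by omega⟩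
  have hs : √3 * √3 = 3 := Real.mul_self_sqrt (by norm_num)
  have hs0 : √3 ≠ 0 := by positivity
  have hτ := numSpanningTrees_polyominoChain m
    -- Closed form of the recurrence, with `√3 / 6 = 1 / (2 √3)`.
    (fun k => √3 * ((2 + √3) ^ k - (2 - √3) ^ k) / 6) (by simp)
    (by linear_combination hs / 3) fun k => by
      simp only [pow_succ]
      linear_combination √3 * ((2 + √3) ^ k - (2 - √3) ^ k) / 6 * hs
  have h := numSpanningTrees_strongPrism (polyominoChain (m + 1))
  rw [prod_polyominoChain_degree, hτ] at h
  simp only [Fintype.card_prod, Fintype.card_fin] at h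
  have e1 : (8 * ((m + 1 : ℕ) : ℤ) - 3) = ((8 * m + 5 : ℕ) : ℤ) := by push_cast; ring
  rw [e1, zpow_natCast]
  have e2 : (2 : ℝ) ^ (2 * (m + 1 + 1)) = 16 * (2 ^ m) ^ 2 := by ring
  have e3 : (8 : ℝ) ^ m = (2 ^ m) ^ 3 := by rw [← pow_mul, mul_comm, pow_mul]; norm_num
  have e4 : (2 : ℝ) ^ (8 * m + 5) = 32 * (2 ^ m) ^ 8 := by ring
  rw [e2, e3] at h
  rw [e4]
  linear_combination h / 4
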